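/- Let $\mathbf k$ be a field of characteristic zero. A post-Lie algebra $(\mathfrak g,\pi_0,\pi_1)$ consists of a $\mathbf k$-vector space $\mathfrak g$ and linear maps $\pi_0:\mathfrak g\wedge\mathfrak g\to\mathfrak g$, $\pi_0(x\wedge y)=[x,y]$, and $\pi_1:\mathfrak g\otimes\mathfrak g\to\mathfrak g$, $\pi_1(x\otimes y)=x\rhd y$, such that $(\mathfrak g,[\cdot,\cdot])$ is a Lie algebra and, for all $x,y,z\in\mathfrak g$, $$x\rhd[y,z]=[x\rhd y,z]+[y,x\rhd z],\qquad ([x,y]+x\rhd y-y\rhd x)\rhd z=x\rhd(y\rhd z)-y\rhd(x\rhd z).$$ For $n\ge 0$ put $C^n_{\mathrm{postLie}}(\mathfrak g,\mathfrak g)=\bigoplus_{i=0}^n\mathrm{Hom}(\wedge^i\mathfrak g\otimes\wedge^{n+1-i}\mathfrak g,\mathfrak g)$, with elements written $f=(f_0,\dots,f_n)$. Let $\mathbb S_{(i_1,\dots,i_r)}$ denote the set of $(i_1,\dots,i_r)$-shuffles, i.e. permutations of $\{1,\dots,i_1+\dots+i_r\}$ increasing on each of the consecutive blocks of lengths $i_1,\dots,i_r$.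 For $f\in C^n_{\mathrm{postLie}}(\mathfrak g,\mathfrak g)$ and $g\in C^m_{\mathrm{postLie}}(\mathfrak g,\mathfrak g)$ define $f\circ g\in C^{n+m}_{\mathrm{postLie}}(\mathfrak g,\mathfrak g)$ by $$\begin{aligned}&(f\circ g)_k(x_1\cdots x_k\otimes x_{k+1}\cdots x_{n+m+1})\\ &=\sum_{0\le j\le m}\ \sum_{\sigma\in\mathbb S_{(j,m+1-j,k-m-1)}}(-1)^\sigma f_{k-m}\big(g_j(x_{\sigma(1)}\cdots x_{\sigma(j)}\otimes x_{\sigma(j+1)}\cdots x_{\sigma(m+1)})\,x_{\sigma(m+2)}\cdots x_{\sigma(k)}\otimes x_{k+1}\cdots x_{n+m+1}\big)\\ &\quad+\sum_{\substack{0\le j\le\min(k,m)\\ k-j\le n}}\ \sum_{\sigma\in\mathbb S_{(k-j,j)}}\ \sum_{\tau\in\mathbb S_{(m+1-j,\,n+j-k)}}(-1)^\sigma(-1)^\tau(-1)^{m(k-j)}\\ &\qquad f_{k-j}\big(x_{\sigma(1)}\cdots x_{\sigma(k-j)}\otimes g_j(x_{\sigma(k-j+1)}\cdots x_{\sigma(k)}\otimes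 x_{k+\tau(1)}\cdots x_{k+\tau(m+1-j)})\,x_{k+\tau(m+2-j)}\cdots x_{k+\tau(n+m+1-k)}\big)\end{aligned}$$ for $0\le k\le n+m$, where the first sum is present only if $k\ge m+1$. Put $[f,g]_{\mathrm{postLie}}=f\circ g-(-1)^{nm}g\circ f$. For a post-Lie algebra $(\mathfrak g,\pi_0,\pi_1)$, regard $\pi=(\pi_0,\pi_1)$ as an element of $C^1_{\mathrm{postLie}}(\mathfrak g,\mathfrak g)$ and put $d_\pi=[\pi,\cdot]_{\mathrm{postLie}}$. **Theorem.** Let $(\mathfrak g,\pi_0,\pi_1)$ be a post-Lie algebra over $\mathbf k$, and let $\pi_0':\mathfrak g\wedge\mathfrak g\to\mathfrak g$ and $\pi_1':\mathfrak g\otimes\mathfrak g\to\mathfrak g$ be linear maps. Then $(\mathfrak g,\pi_0+\pi_0',\pi_1+\pi_1')$ is a post-Lie algebra if and only if $\pi'=(\pi_0',\pi_1')\in C^1_{\mathrm{postLie}}(\mathfrak g,\mathfrak g)$ is a Maurer–Cartan element of the dg Lie algebra $(C^*_{\mathrm{postLie}}(\mathfrak g,\mathfrak g),[\cdot,\cdot]_{\mathrm{postLie}},d_\pi)$,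 i.e. if and only if $$d_\pi\pi'+\tfrac12[\pi',\pi']_{\mathrm{postLie}}=0.$$ -/

import Mathlib

open scoped TensorProduct

noncomputable section

namespace PostLie

variable {k : Type*} [Field k] {V : Type*} [AddCommGroup V] [Module k V]

/-- `(V, π₀, π₁)` is a post-Lie algebra, where `π₀ : V ∧ V → V` is the bracket `[x, y]` and
`π₁ : V ⊗ V → V` is the product `x ▷ y`. Bilinearity of both operations and the alternation of the
bracket are contained in the types of `π₀` and `π₁`. -/
structure IsPostLieAlgebra (π₀ : ⋀[k]^2 V →ₗ[k] V) (π₁ : V ⊗[k] V →ₗ[k] V) : Prop where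
  /-- The Jacobi identity `[x, [y, z]] + [y, [z, x]] + [z, [x, y]] = 0`. -/
  jacobi : ∀ x y z : V,
    π₀ (exteriorPower.ιMulti k 2 ![x, π₀ (exteriorPower.ιMulti k 2 ![y, z])])
      + π₀ (exteriorPower.ιMulti k 2 ![y, π₀ (exteriorPower.ιMulti k 2 ![z, x])])
      + π₀ (exteriorPower.ιMulti k 2 ![z, π₀ (exteriorPower.ιMulti k 2 ![x, y])]) = 0
  /-- `x ▷ [y, z] = [x ▷ y, z] + [y, x ▷ z]`. -/
  derivation : ∀ x y z : V,
    π₁ (x ⊗ₜ π₀ (exteriorPower.ιMulti k 2 ![y, z]))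
      = π₀ (exteriorPower.ιMulti k 2 ![π₁ (x ⊗ₜ y), z])
        + π₀ (exteriorPower.ιMulti k 2 ![y, π₁ (x ⊗ₜ z)])
  /-- `([x, y] + x ▷ y - y ▷ x) ▷ z = x ▷ (y ▷ z) - y ▷ (x ▷ z)`. -/
  action : ∀ x y z : V,
    π₁ ((π₀ (exteriorPower.ιMulti k 2 ![x, y]) + π₁ (x ⊗ₜ y) - π₁ (y ⊗ₜ x)) ⊗ₜ z)
      = π₁ (x ⊗ₜ π₁ (y ⊗ₜ z)) - π₁ (y ⊗ₜ π₁ (x ⊗ₜ z))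

/-- The unshuffle map `⋀ⁿ V → ⋀ᵖ V ⊗ ⋀^q V` for `p + q = n`,
`x₁ ⋯ xₙ ↦ ∑_{σ ∈ S_(p,q)} (-1)^σ x_{σ(1)} ⋯ x_{σ(p)} ⊗ x_{σ(p+1)} ⋯ x_{σ(n)}`,
the sum being over the `(p, q)`-shuffles. (`AlternatingMap.domCoprod` sums over the cosets of
`S_p × S_q` in `S_n`, of which the shuffles are representatives.) -/
def unshuffle {p q n : ℕ} (h : p + q = n) : ⋀[k]^n V →ₗ[k] ⋀[k]^p V ⊗[k] ⋀[k]^q V :=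
  exteriorPower.alternatingMapLinearEquiv (N := ⋀[k]^p V ⊗[k] ⋀[k]^q V)
    (((exteriorPower.ιMulti k p (M := V)).domCoprod (exteriorPower.ιMulti k q (M := V))).domDomCongr
      (finSumFinEquiv.trans (finCongr h)))

/-- Left multiplication `V ⊗ ⋀ʳ V → ⋀^(r+1) V`, `v ⊗ x₁ ⋯ xᵣ ↦ v x₁ ⋯ xᵣ`. -/
def wedgeLeft (r : ℕ) : V ⊗[k] ⋀[k]^r V →ₗ[k] ⋀[k]^(r + 1) V :=
  TensorProduct.lift
    ((exteriorPower.alternatingMapLinearEquiv (R := k) (M := V) (N := ⋀[k]^(r + 1) V)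
      (n := r)).toLinearMap ∘ₗ (exteriorPower.ιMulti k (r + 1)).curryLeft)

variable (k V) in
/-- The space `C^n(V, V) = ⨁_{i = 0}^{n} Hom(⋀^i V ⊗ ⋀^(n+1-i) V, V)`. The component `f_i` is indexed
by the pair `(i, n - i)`, so that `⋀^(n+1-i) V` is `⋀^(q+1) V` with `q = n - i`. -/
abbrev Cochain (n : ℕ) : Type _ :=
  (i : Finset.HasAntidiagonal.antidiagonal n) → (⋀[k]^i.1.1 V ⊗[k] ⋀[k]^(i.1.2 + 1) V →ₗ[k] V)

/-- The component `f_p : ⋀ᵖ V ⊗ ⋀^(q+1) V → V` of `f ∈ C^n(V, V)`, where `p + q = n`. -/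
def Cochain.component {n : ℕ} (f : Cochain k V n) (p q : ℕ) (h : p + q = n) :
    ⋀[k]^p V ⊗[k] ⋀[k]^(q + 1) V →ₗ[k] V :=
  f ⟨(p, q), Finset.HasAntidiagonal.mem_antidiagonal.mpr h⟩

/-- Insertion of `g_j`, `g ∈ C^m(V, V)`, `j + c = m`, in the left (first) tensor factor: the map
`⋀ᵖ V ⊗ ⋀^(q+1) V → ⋀^(r+1) V ⊗ ⋀^(q+1) V`, `m + 1 + r = p`, that sends `x₁ ⋯ xₚ ⊗ y` to
`∑_{σ ∈ S_(j, m+1-j, r)} (-1)^σ g_j(x_{σ(1)} ⋯ x_{σ(j)} ⊗ x_{σ(j+1)} ⋯ x_{σ(m+1)}) x_{σ(m+2)} ⋯ x_{σ(p)} ⊗ y`.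
-/
def insertLeft {j c r p : ℕ} (q : ℕ) (g : ⋀[k]^j V ⊗[k] ⋀[k]^(c + 1) V →ₗ[k] V)
    (h : (j + (c + 1)) + r = p) :
    ⋀[k]^p V ⊗[k] ⋀[k]^(q + 1) V →ₗ[k] ⋀[k]^(r + 1) V ⊗[k] ⋀[k]^(q + 1) V :=
  (wedgeLeft r ∘ₗ (g ∘ₗ unshuffle rfl).rTensor (⋀[k]^r V) ∘ₗ unshuffle h).rTensor
    (⋀[k]^(q + 1) V)

/-- Insertion of `g_j`, `g ∈ C^m(V, V)`, `j + c = m`, in the right (second) tensor factor: the map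
`⋀ᵖ V ⊗ ⋀^(q+1) V → ⋀^a V ⊗ ⋀^(d+1) V`, `a + j = p`, `c + d = q`, that sends
`x₁ ⋯ xₚ ⊗ y₁ ⋯ y_(q+1)` to
`∑_{σ ∈ S_(a, j)} ∑_{τ ∈ S_(c+1, d)} (-1)^σ (-1)^τ
  x_{σ(1)} ⋯ x_{σ(a)} ⊗ g_j(x_{σ(a+1)} ⋯ x_{σ(p)} ⊗ y_{τ(1)} ⋯ y_{τ(c+1)}) y_{τ(c+2)} ⋯ y_{τ(q+1)}`.
-/
def insertRight {a j c d p q : ℕ} (g : ⋀[k]^j V ⊗[k] ⋀[k]^(c + 1) V →ₗ[k] V)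
    (h : a + j = p) (h' : (c + 1) + d = q + 1) :
    ⋀[k]^p V ⊗[k] ⋀[k]^(q + 1) V →ₗ[k] ⋀[k]^a V ⊗[k] ⋀[k]^(d + 1) V :=
  (wedgeLeft d ∘ₗ g.rTensor (⋀[k]^d V) ∘ₗ
      (TensorProduct.assoc k (⋀[k]^j V) (⋀[k]^(c + 1) V) (⋀[k]^d V)).symm.toLinearMap).lTensor
        (⋀[k]^a V) ∘ₗ
    (TensorProduct.assoc k (⋀[k]^a V) (⋀[k]^j V)
      (⋀[k]^(c + 1) V ⊗[k] ⋀[k]^d V)).toLinearMap ∘ₗ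
    TensorProduct.map (unshuffle h) (unshuffle h')

/-- The component of the composition `f ∘ g` of `f ∈ C^n(V, V)` and `g ∈ C^m(V, V)` on
`⋀ᵖ V ⊗ ⋀^(q+1) V`, `p + q = n + m`. It is the sum of
* (if `p ≥ m + 1`) the terms `f_{p-m}(g_j(x ⋯ ⊗ x ⋯) x ⋯ ⊗ y ⋯)` for `0 ≤ j ≤ m`, and of
* the terms `(-1)^{m(p-j)} f_{p-j}(x ⋯ ⊗ g_j(x ⋯ ⊗ y ⋯) y ⋯)` for `0 ≤ j ≤ min(p, m)`,
  `p - j ≤ n`,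

each summed over shuffles with signs. -/
def circComponent {n m : ℕ} (f : Cochain k V n) (g : Cochain k V m) (p q : ℕ)
    (hpq : p + q = n + m) : ⋀[k]^p V ⊗[k] ⋀[k]^(q + 1) V →ₗ[k] V :=
  (if hp : m + 1 ≤ p then
    ∑ j : Fin (m + 1),
      f.component (p - (m + 1) + 1) q (by omega) ∘ₗ
        insertLeft (r := p - (m + 1)) (p := p) q (g.component j (m - j) (by omega)) (by omega)
    else 0) +
  ∑ j : Fin (m + 1),
    if hj : j ≤ p ∧ p - j ≤ n then
      (-1 : k) ^ (m * (p - j)) •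
        (f.component (p - j) (n - (p - j)) (by omega) ∘ₗ
          insertRight (a := p - j) (d := n - (p - j)) (p := p) (q := q)
            (g.component j (m - j) (by omega)) (by omega) (by omega))
    else 0

/-- The composition `f ∘ g ∈ C^(n+m)(V, V)`. The degree `N = n + m` is a separate argument, so that
`f ∘ g` and `g ∘ f` can be given the same type. -/
def circ {n m N : ℕ} (hN : n + m = N) (f : Cochain k V n) (g : Cochain k V m) : Cochain k V N :=
  fun i => circComponent f g i.1.1 i.1.2
    ((Finset.HasAntidiagonal.mem_antidiagonal.mp i.2).trans hN.symm)

/-- The graded bracket `[f, g] = f ∘ g - (-1)^{nm} g ∘ f` on `C^*(V, V)`, for `f ∈ C^n(V, V)` and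
`g ∈ C^m(V, V)`. -/
def bracket {n m : ℕ} (f : Cochain k V n) (g : Cochain k V m) : Cochain k V (n + m) :=
  circ rfl f g - (-1 : k) ^ (n * m) • circ (Nat.add_comm m n) g f

/-- The operator `d_π = [π, ·]` of degree one on `C^*(V, V)`, for `π ∈ C^1(V, V)`. -/
def differential (π : Cochain k V 1) {n : ℕ} (f : Cochain k V n) : Cochain k V (1 + n) :=
  bracket π f

/-- The Maurer–Cartan equation `d_π ω + ½ [ω, ω] = 0` of `(C^*(V, V), [·,·], d_π)` for an element
`ω` of degree one. -/
def IsMaurerCartan (π ω : Cochain k V 1) : Prop :=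
  differential π ω + (2⁻¹ : k) • bracket ω ω = 0

/-- The element `π = (π₀, π₁)` of `C^1(V, V) = Hom(⋀⁰ V ⊗ ⋀² V, V) ⊕ Hom(⋀¹ V ⊗ ⋀¹ V, V)`, under the
identifications `⋀⁰ V = k` and `⋀¹ V = V`. (The last case of the match does not occur, as `i + j = 1`.) -/
def ofPair (π₀ : ⋀[k]^2 V →ₗ[k] V) (π₁ : V ⊗[k] V →ₗ[k] V) : Cochain k V 1 :=
  fun i => match i with
    | ⟨(0, 1), _⟩ =>
      π₀ ∘ₗ (TensorProduct.lid k (⋀[k]^2 V)).toLinearMap ∘ₗ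
        (exteriorPower.zeroEquiv k V).toLinearMap.rTensor (⋀[k]^2 V)
    | ⟨(1, 0), _⟩ =>
      π₁ ∘ₗ TensorProduct.map (exteriorPower.oneEquiv k V).toLinearMap
        (exteriorPower.oneEquiv k V).toLinearMap
    | ⟨(_, _), _⟩ => 0

end PostLie

end

/-!
A pair `π = (π₀, π₁)` is a post-Lie structure exactly when `π ∘ π = 0` in `C^2(V, V)`
(`isPostLieAlgebra_iff_circ_self_eq_zero`): on decomposable elements the three components of `π ∘ π`
are, up to sign, the Jacobiator, the defect of the derivation rule and the defect of the action
axiom.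

The theorem follows formally. The composition is biadditive, so
`(π + ω) ∘ (π + ω) = π ∘ π + (π ∘ ω + ω ∘ π + ω ∘ ω)` (`circ_add_self`). As `π` and `ω` have degree
one, the sum in parentheses is `[π, ω] + ½ [ω, ω]` (`isMaurerCartan_iff`), and `π ∘ π` vanishes
because `π` is a post-Lie structure.

The components of `π ∘ π` are evaluated from the few unshuffle maps that occur in degree two. Each of
them is computed from the sum over all permutations, which in characteristic zero determines the sum
over shuffles.
-/

noncomputable section

namespace PostLie

open exteriorPower

/-! ### Unshuffles in low degree -/

section Unshuffle

variable {k : Type*} [Field k] {V : Type*} [AddCommGroup V] [Module k V]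

/-- The cosets of `S_p × S_q` in `S_n` have `p! q!` elements each, so a sum over all permutations
computes `p! q!` times the unshuffle. In characteristic zero this determines the unshuffle, and no
coset representatives have to be chosen. -/
theorem factorial_smul_unshuffle_ιMulti {p q n : ℕ} (h : p + q = n) (v : Fin n → V) :
    (p.factorial * q.factorial) • unshuffle h (ιMulti k n v) =
      ∑ σ : Equiv.Perm (Fin n), Equiv.Perm.sign σ •
        (ιMulti k p (fun i => v (σ (Fin.cast h (Fin.castAdd q i)))) ⊗ₜ[k]
          ιMulti k q (fun i => v (σ (Fin.cast h (Fin.natAdd p i))))) := by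
  subst h
  have key := congrArg (fun F => F (fun i => v (finSumFinEquiv i)))
    (MultilinearMap.domCoprod_alternization_eq (ιMulti k p (M := V)) (ιMulti k q (M := V)))
  simp only [MultilinearMap.alternatization_apply, AlternatingMap.smul_apply,
    Fintype.card_fin] at key
  rw [unshuffle, alternatingMapLinearEquiv_apply_ιMulti]
  refine key.symm.trans ?_
  refine Fintype.sum_equiv finSumFinEquiv.permCongr _ _ fun σ => ?_
  rw [Equiv.Perm.sign_permCongr]
  congr 1
  simp [MultilinearMap.domCoprod_apply, Equiv.permCongr_apply]

theorem unshuffle_ιMulti_zero_right [CharZero k] {p : ℕ} (h : p + 0 = p) (v : Fin p → V)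
    (w : Fin 0 → V) :
    unshuffle h (ιMulti k p v) = ιMulti k p v ⊗ₜ[k] ιMulti k 0 w := by
  have := factorial_smul_unshuffle_ιMulti (k := k) h v
  have h2 : ∀ σ : Equiv.Perm (Fin p), Equiv.Perm.sign σ •
        (ιMulti k p (fun i => v (σ (Fin.cast h (Fin.castAdd 0 i)))) ⊗ₜ[k]
          ιMulti k 0 (fun i => v (σ (Fin.cast h (Fin.natAdd p i))))) =
          ιMulti k p v ⊗ₜ[k] ιMulti k 0 w := by
    intro σ
    rw [Subsingleton.elim (fun i => v (σ (Fin.cast h (Fin.natAdd p i)))) w]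
    have := (ιMulti k p (M := V)).map_perm v σ
    change _ • ((ιMulti k p (v ∘ σ)) ⊗ₜ[k] _) = _
    rw [this]
    obtain hs | hs := Int.units_eq_one_or (Equiv.Perm.sign σ)
    · simp [hs]
    · simp only [hs, Units.neg_smul, one_smul, TensorProduct.neg_tmul]
      exact neg_neg (ιMulti k p v ⊗ₜ[k] ιMulti k 0 w)
  rw [Finset.sum_congr rfl fun σ _ => h2 σ, Finset.sum_const, Finset.card_univ,
    Fintype.card_perm, Fintype.card_fin, Nat.factorial_zero, mul_one,
    ← Nat.cast_smul_eq_nsmul k, ← Nat.cast_smul_eq_nsmul k] at this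
  exact smul_right_injective _ (Nat.cast_ne_zero.mpr p.factorial_ne_zero) this

theorem unshuffle_ιMulti_zero_left [CharZero k] {q : ℕ} (h : 0 + q = q) (v : Fin q → V)
    (w : Fin 0 → V) :
    unshuffle h (ιMulti k q v) = ιMulti k 0 w ⊗ₜ[k] ιMulti k q v := by
  have := factorial_smul_unshuffle_ιMulti (k := k) h v
  have h2 : ∀ σ : Equiv.Perm (Fin q), Equiv.Perm.sign σ •
        (ιMulti k 0 (fun i => v (σ (Fin.cast h (Fin.castAdd q i)))) ⊗ₜ[k]
          ιMulti k q (fun i => v (σ (Fin.cast h (Fin.natAdd 0 i))))) =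
          ιMulti k 0 w ⊗ₜ[k] ιMulti k q v := by
    intro σ
    rw [Subsingleton.elim (fun i => v (σ (Fin.cast h (Fin.castAdd q i)))) w]
    have := (ιMulti k q (M := V)).map_perm v σ
    have h3 : (fun i => v (σ (Fin.cast h (Fin.natAdd 0 i)))) = v ∘ σ := by
      ext i; simp
    rw [h3, this]
    obtain hs | hs := Int.units_eq_one_or (Equiv.Perm.sign σ)
    · simp [hs]
    · simp only [hs, Units.neg_smul, one_smul, TensorProduct.tmul_neg]
      exact neg_neg (ιMulti k 0 w ⊗ₜ[k] ιMulti k q v)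
  rw [Finset.sum_congr rfl fun σ _ => h2 σ, Finset.sum_const, Finset.card_univ,
    Fintype.card_perm, Fintype.card_fin, Nat.factorial_zero, one_mul,
    ← Nat.cast_smul_eq_nsmul k, ← Nat.cast_smul_eq_nsmul k] at this
  exact smul_right_injective _ (Nat.cast_ne_zero.mpr q.factorial_ne_zero) this

theorem unshuffle_ιMulti_one_one (h : 1 + 1 = 2) (x y : V) :
    unshuffle h (ιMulti k 2 ![x, y]) =
      ιMulti k 1 ![x] ⊗ₜ[k] ιMulti k 1 ![y] +
        (-1 : k) • (ιMulti k 1 ![y] ⊗ₜ[k] ιMulti k 1 ![x]) := by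
  have key := factorial_smul_unshuffle_ιMulti (k := k) h ![x, y]
  have hu : (Finset.univ : Finset (Equiv.Perm (Fin 2))) = {1, Equiv.swap 0 1} := by decide
  have term (σ : Equiv.Perm (Fin 2)) :
      (ιMulti k 1 (fun i => ![x, y] (σ (Fin.cast h (Fin.castAdd 1 i)))) ⊗ₜ[k]
        ιMulti k 1 (fun i => ![x, y] (σ (Fin.cast h (Fin.natAdd 1 i))))) =
      ιMulti k 1 ![![x, y] (σ 0)] ⊗ₜ[k] ιMulti k 1 ![![x, y] (σ 1)] := by
    congr 2 <;> ext i <;> fin_cases i <;> rfl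
  simp only [term] at key
  rw [hu, Finset.sum_pair (by decide)] at key
  simp at key
  rw [key]
  congr 1

/-- The three `(2, 1)`-shuffles, written cyclically: the sign of the term that contains `y` last is
absorbed into the order of `z` and `x`. -/
theorem unshuffle_ιMulti_two_one [CharZero k] (h : 2 + 1 = 3) (x y z : V) :
    unshuffle h (ιMulti k 3 ![x, y, z]) =
      ιMulti k 2 ![x, y] ⊗ₜ[k] ιMulti k 1 ![z] + ιMulti k 2 ![y, z] ⊗ₜ[k] ιMulti k 1 ![x] +
        ιMulti k 2 ![z, x] ⊗ₜ[k] ιMulti k 1 ![y] := by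
  have key := factorial_smul_unshuffle_ιMulti (k := k) h ![x, y, z]
  have hu : (Finset.univ : Finset (Equiv.Perm (Fin 3))) =
    {1, Equiv.swap 0 1, Equiv.swap 1 2, Equiv.swap 0 2,
      Equiv.swap 0 1 * Equiv.swap 1 2, Equiv.swap 1 2 * Equiv.swap 0 1} := by decide
  have term (σ : Equiv.Perm (Fin 3)) :
      (ιMulti k 2 (fun i => ![x, y, z] (σ (Fin.cast h (Fin.castAdd 1 i)))) ⊗ₜ[k]
        ιMulti k 1 (fun i => ![x, y, z] (σ (Fin.cast h (Fin.natAdd 2 i))))) =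
      ιMulti k 2 ![![x, y, z] (σ 0), ![x, y, z] (σ 1)] ⊗ₜ[k]
        ιMulti k 1 ![![x, y, z] (σ 2)] := by
    congr 2 <;> ext i <;> fin_cases i <;> rfl
  simp only [term] at key
  have sw (a b : V) : ιMulti k 2 ![b, a] = - ιMulti k 2 ![a, b] := by
    rw [← (ιMulti k 2 (M := V)).map_swap ![a, b] (i := 0) (j := 1) (by decide)]
    congr 1
    ext i; fin_cases i <;> rfl
  rw [hu, Finset.sum_insert (by decide), Finset.sum_insert (by decide),
    Finset.sum_insert (by decide), Finset.sum_insert (by decide), Finset.sum_pair (by decide)] at key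
  have s1 : Equiv.Perm.sign (Equiv.swap (0 : Fin 3) 1) = -1 := by decide
  have s2 : Equiv.Perm.sign (Equiv.swap (1 : Fin 3) 2) = -1 := by decide
  have s3 : Equiv.Perm.sign (Equiv.swap (0 : Fin 3) 2) = -1 := by decide
  have a1 : Equiv.swap (0 : Fin 3) 1 2 = 2 := by decide
  have a2 : Equiv.swap (1 : Fin 3) 2 0 = 0 := by decide
  have a3 : Equiv.swap (0 : Fin 3) 2 1 = 1 := by decide
  have v0 : ![x, y, z] 0 = x := rfl
  have v1 : ![x, y, z] 1 = y := rfl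
  have v2 : ![x, y, z] 2 = z := rfl
  simp only [Equiv.Perm.mul_apply, Equiv.Perm.one_apply, Equiv.swap_apply_left,
    Equiv.swap_apply_right, a1, a2, a3, v0, v1, v2, sw x y, sw y z, sw z x,
    Equiv.Perm.sign_mul, s1, s2, s3, Equiv.Perm.sign_one, TensorProduct.neg_tmul,
    one_smul, mul_neg, mul_one, neg_neg, Units.neg_smul] at key
  -- The coset of each shuffle has `2! * 1! = 2` elements; both contribute the same term.
  refine smul_right_injective _ (two_ne_zero (α := k)) ?_
  change (2 : k) • _ = (2 : k) • _
  rw [two_smul, ← two_nsmul]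
  refine key.trans ?_
  rw [two_smul]
  abel

theorem wedgeLeft_tmul_ιMulti (r : ℕ) (v : V) (x : Fin r → V) :
    wedgeLeft r (v ⊗ₜ[k] ιMulti k r x) = ιMulti k (r + 1) (Matrix.vecCons v x) := by
  simp [wedgeLeft]

end Unshuffle

/-! ### The composition of two elements of degree one -/

section Circ

variable {k : Type*} [Field k] {V : Type*} [AddCommGroup V] [Module k V]

theorem ofPair_zero_one_apply (a : ⋀[k]^2 V →ₗ[k] V) (b : V ⊗[k] V →ₗ[k] V) (w : Fin 0 → V)
    (t : ⋀[k]^2 V) :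
    (ofPair a b).component 0 1 rfl (ιMulti k 0 w ⊗ₜ[k] t) = a t := by
  change a (TensorProduct.lid k _ (zeroEquiv k V (ιMulti k 0 w) ⊗ₜ[k] t)) = _
  simp

theorem ofPair_one_zero_apply (a : ⋀[k]^2 V →ₗ[k] V) (b : V ⊗[k] V →ₗ[k] V) (x y : V) :
    (ofPair a b).component 1 0 rfl (ιMulti k 1 ![x] ⊗ₜ[k] ιMulti k 1 ![y]) = b (x ⊗ₜ[k] y) := by
  change b (oneEquiv k V (ιMulti k 1 ![x]) ⊗ₜ[k] oneEquiv k V (ιMulti k 1 ![y])) = _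
  simp

theorem circComponent_zero_two (f g : Cochain k V 1) :
    circComponent f g 0 2 rfl = f.component 0 1 rfl ∘ₗ
      insertRight (a := 0) (d := 1) (g.component 0 1 rfl) rfl rfl := by
  simp [circComponent]

theorem circComponent_one_one (f g : Cochain k V 1) :
    circComponent f g 1 1 rfl =
      f.component 0 1 rfl ∘ₗ insertRight (a := 0) (d := 1) (g.component 1 0 rfl) rfl rfl
      - f.component 1 0 rfl ∘ₗ insertRight (a := 1) (d := 0) (g.component 0 1 rfl) rfl rfl := by
  simp only [circComponent]
  simp
  -- The sum over `j` puts the term of `g₀` first.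
  exact (add_comm _ _).trans (sub_eq_add_neg _ _).symm

theorem circComponent_two_zero (f g : Cochain k V 1) :
    circComponent f g 2 0 rfl =
      f.component 1 0 rfl ∘ₗ insertLeft (r := 0) 0 (g.component 0 1 rfl) rfl
      + f.component 1 0 rfl ∘ₗ insertLeft (r := 0) 0 (g.component 1 0 rfl) rfl
      - f.component 1 0 rfl ∘ₗ insertRight (a := 1) (d := 0) (g.component 1 0 rfl) rfl rfl := by
  simp [circComponent, Fin.sum_univ_two, sub_eq_add_neg]

variable [CharZero k]

theorem insertRight_zero_two (g : ⋀[k]^0 V ⊗[k] ⋀[k]^2 V →ₗ[k] V) (w : Fin 0 → V) (x y z : V) :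
    insertRight (a := 0) (j := 0) (c := 1) (d := 1) (p := 0) (q := 2) g rfl rfl
        (ιMulti k 0 w ⊗ₜ[k] ιMulti k 3 ![x, y, z]) =
      ιMulti k 0 w ⊗ₜ[k] ιMulti k 2 ![g (ιMulti k 0 w ⊗ₜ[k] ιMulti k 2 ![x, y]), z]
        + ιMulti k 0 w ⊗ₜ[k] ιMulti k 2 ![g (ιMulti k 0 w ⊗ₜ[k] ιMulti k 2 ![y, z]), x]
        + ιMulti k 0 w ⊗ₜ[k] ιMulti k 2 ![g (ιMulti k 0 w ⊗ₜ[k] ιMulti k 2 ![z, x]), y] := by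
  simp only [insertRight, LinearMap.comp_apply, TensorProduct.map_tmul]
  rw [unshuffle_ιMulti_zero_left _ w w]
  -- The degrees here are `1 + 1` and `2 + 1`, equal to `2` and `3` only by definition.
  erw [unshuffle_ιMulti_two_one]
  simp only [TensorProduct.tmul_add, map_add,
    LinearEquiv.coe_coe, TensorProduct.assoc_tmul, LinearMap.lTensor_tmul, LinearMap.comp_apply,
    TensorProduct.assoc_symm_tmul, LinearMap.rTensor_tmul, wedgeLeft_tmul_ιMulti]

theorem insertRight_one_one_of_one_one (g : ⋀[k]^1 V ⊗[k] ⋀[k]^1 V →ₗ[k] V) (w : Fin 0 → V)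
    (x y z : V) :
    insertRight (a := 0) (j := 1) (c := 0) (d := 1) (p := 1) (q := 1) g rfl rfl
        (ιMulti k 1 ![x] ⊗ₜ[k] ιMulti k 2 ![y, z]) =
      ιMulti k 0 w ⊗ₜ[k] ιMulti k 2 ![g (ιMulti k 1 ![x] ⊗ₜ[k] ιMulti k 1 ![y]), z]
        + (-1 : k) •
          (ιMulti k 0 w ⊗ₜ[k] ιMulti k 2 ![g (ιMulti k 1 ![x] ⊗ₜ[k] ιMulti k 1 ![z]), y]) := by
  simp only [insertRight, LinearMap.comp_apply, TensorProduct.map_tmul]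
  rw [unshuffle_ιMulti_zero_left (q := 1) _ ![x] w]
  erw [unshuffle_ιMulti_one_one]
  simp only [TensorProduct.tmul_add, TensorProduct.tmul_smul, map_add, map_smul,
    LinearEquiv.coe_coe, TensorProduct.assoc_tmul, LinearMap.lTensor_tmul, LinearMap.comp_apply,
    TensorProduct.assoc_symm_tmul, LinearMap.rTensor_tmul, wedgeLeft_tmul_ιMulti]

theorem insertRight_one_one_of_zero_two (g : ⋀[k]^0 V ⊗[k] ⋀[k]^2 V →ₗ[k] V) (w : Fin 0 → V)
    (x y z : V) :
    insertRight (a := 1) (j := 0) (c := 1) (d := 0) (p := 1) (q := 1) g rfl rfl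
        (ιMulti k 1 ![x] ⊗ₜ[k] ιMulti k 2 ![y, z]) =
      ιMulti k 1 ![x] ⊗ₜ[k] ιMulti k 1 ![g (ιMulti k 0 w ⊗ₜ[k] ιMulti k 2 ![y, z])] := by
  simp only [insertRight, LinearMap.comp_apply, TensorProduct.map_tmul]
  rw [unshuffle_ιMulti_zero_right (p := 1) _ ![x] w]
  erw [unshuffle_ιMulti_zero_right (p := 2) _ ![y, z] ![]]
  simp only [LinearEquiv.coe_coe, TensorProduct.assoc_tmul, LinearMap.lTensor_tmul,
    LinearMap.comp_apply, TensorProduct.assoc_symm_tmul, LinearMap.rTensor_tmul,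
    wedgeLeft_tmul_ιMulti]

theorem insertRight_two_zero (g : ⋀[k]^1 V ⊗[k] ⋀[k]^1 V →ₗ[k] V) (x y z : V) :
    insertRight (a := 1) (j := 1) (c := 0) (d := 0) (p := 2) (q := 0) g rfl rfl
        (ιMulti k 2 ![x, y] ⊗ₜ[k] ιMulti k 1 ![z]) =
      ιMulti k 1 ![x] ⊗ₜ[k] ιMulti k 1 ![g (ιMulti k 1 ![y] ⊗ₜ[k] ιMulti k 1 ![z])]
      + (-1 : k) •
        (ιMulti k 1 ![y] ⊗ₜ[k] ιMulti k 1 ![g (ιMulti k 1 ![x] ⊗ₜ[k] ιMulti k 1 ![z])]) := by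
  simp only [insertRight, LinearMap.comp_apply, TensorProduct.map_tmul]
  rw [unshuffle_ιMulti_one_one]
  have hz := unshuffle_ιMulti_zero_right (k := k) (p := 1) rfl ![z] ![]
  erw [hz]
  simp only [TensorProduct.add_tmul, ← TensorProduct.smul_tmul', map_add, map_smul,
    LinearEquiv.coe_coe, TensorProduct.assoc_tmul, LinearMap.lTensor_tmul, LinearMap.comp_apply,
    TensorProduct.assoc_symm_tmul, LinearMap.rTensor_tmul, wedgeLeft_tmul_ιMulti]

theorem insertLeft_zero_two (g : ⋀[k]^0 V ⊗[k] ⋀[k]^2 V →ₗ[k] V) (w : Fin 0 → V) (x y : V)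
    (t : ⋀[k]^1 V) :
    insertLeft (j := 0) (c := 1) (r := 0) (p := 2) 0 g rfl (ιMulti k 2 ![x, y] ⊗ₜ[k] t) =
      ιMulti k 1 ![g (ιMulti k 0 w ⊗ₜ[k] ιMulti k 2 ![x, y])] ⊗ₜ[k] t := by
  simp only [insertLeft, LinearMap.comp_apply, LinearMap.rTensor_tmul]
  erw [unshuffle_ιMulti_zero_right (p := 2) _ ![x, y] ![]]
  simp only [LinearMap.comp_apply, LinearMap.rTensor_tmul]
  erw [unshuffle_ιMulti_zero_left (q := 2) _ ![x, y] w]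
  simp only [wedgeLeft_tmul_ιMulti]

theorem insertLeft_one_one (g : ⋀[k]^1 V ⊗[k] ⋀[k]^1 V →ₗ[k] V) (x y : V) (t : ⋀[k]^1 V) :
    insertLeft (j := 1) (c := 0) (r := 0) (p := 2) 0 g rfl (ιMulti k 2 ![x, y] ⊗ₜ[k] t) =
      ιMulti k 1 ![g (ιMulti k 1 ![x] ⊗ₜ[k] ιMulti k 1 ![y])
        + (-1 : k) • g (ιMulti k 1 ![y] ⊗ₜ[k] ιMulti k 1 ![x])] ⊗ₜ[k] t := by
  simp only [insertLeft, LinearMap.comp_apply, LinearMap.rTensor_tmul]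
  erw [unshuffle_ιMulti_zero_right (p := 2) _ ![x, y] ![]]
  simp only [LinearMap.comp_apply, LinearMap.rTensor_tmul]
  erw [unshuffle_ιMulti_one_one]
  simp only [map_add, map_smul, wedgeLeft_tmul_ιMulti]

variable (a a' : ⋀[k]^2 V →ₗ[k] V) (b b' : V ⊗[k] V →ₗ[k] V)

/-- For `(a, b) = (a', b')` this is, up to sign, the Jacobiator of the bracket `a`. -/
theorem circComponent_zero_two_apply (w : Fin 0 → V) (x y z : V) :
    circComponent (ofPair a b) (ofPair a' b') 0 2 rfl (ιMulti k 0 w ⊗ₜ[k] ιMulti k 3 ![x, y, z]) =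
      a (ιMulti k 2 ![a' (ιMulti k 2 ![x, y]), z]) + a (ιMulti k 2 ![a' (ιMulti k 2 ![y, z]), x])
        + a (ιMulti k 2 ![a' (ιMulti k 2 ![z, x]), y]) := by
  rw [circComponent_zero_two]
  simp only [LinearMap.comp_apply]
  erw [insertRight_zero_two]
  simp only [map_add, ofPair_zero_one_apply]

/-- For `(a, b) = (a', b')` this measures the failure of `x ▷ ·` to be a derivation of the bracket. -/
theorem circComponent_one_one_apply (x y z : V) :
    circComponent (ofPair a b) (ofPair a' b') 1 1 rfl (ιMulti k 1 ![x] ⊗ₜ[k] ιMulti k 2 ![y, z]) =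
      a (ιMulti k 2 ![b' (x ⊗ₜ[k] y), z]) - a (ιMulti k 2 ![b' (x ⊗ₜ[k] z), y])
        - b (x ⊗ₜ[k] a' (ιMulti k 2 ![y, z])) := by
  rw [circComponent_one_one]
  simp only [LinearMap.comp_apply, LinearMap.sub_apply]
  erw [insertRight_one_one_of_one_one _ ![], insertRight_one_one_of_zero_two _ ![]]
  simp only [map_add, map_smul, ofPair_zero_one_apply, ofPair_one_zero_apply]
  module

/-- For `(a, b) = (a', b')` this measures the failure of the action axiom of a post-Lie algebra.
The two left insertions give `[x, y]` and `x ▷ y - y ▷ x`. -/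
theorem circComponent_two_zero_apply (x y z : V) :
    circComponent (ofPair a b) (ofPair a' b') 2 0 rfl (ιMulti k 2 ![x, y] ⊗ₜ[k] ιMulti k 1 ![z]) =
      b ((a' (ιMulti k 2 ![x, y]) + b' (x ⊗ₜ[k] y) - b' (y ⊗ₜ[k] x)) ⊗ₜ[k] z)
        - (b (x ⊗ₜ[k] b' (y ⊗ₜ[k] z)) - b (y ⊗ₜ[k] b' (x ⊗ₜ[k] z))) := by
  rw [circComponent_two_zero]
  simp only [LinearMap.comp_apply, LinearMap.sub_apply, LinearMap.add_apply]
  erw [insertLeft_zero_two _ ![], insertLeft_one_one, insertRight_two_zero]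
  simp only [map_add, map_smul, map_sub, ofPair_zero_one_apply, ofPair_one_zero_apply,
    TensorProduct.add_tmul, TensorProduct.sub_tmul, ← TensorProduct.smul_tmul']
  module

end Circ

/-! ### Additivity of the composition -/

section Additivity

variable {k : Type*} [Field k] {V : Type*} [AddCommGroup V] [Module k V]

theorem component_add {n : ℕ} (f g : Cochain k V n) (p q : ℕ) (h : p + q = n) :
    (f + g).component p q h = f.component p q h + g.component p q h := rfl

theorem insertLeft_add {j c r p : ℕ} (q : ℕ) (g g' : ⋀[k]^j V ⊗[k] ⋀[k]^(c + 1) V →ₗ[k] V)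
    (h : (j + (c + 1)) + r = p) :
    insertLeft q (g + g') h = insertLeft q g h + insertLeft q g' h := by
  simp only [insertLeft, LinearMap.add_comp, LinearMap.comp_add, LinearMap.rTensor_add]

theorem insertRight_add {a j c d p q : ℕ} (g g' : ⋀[k]^j V ⊗[k] ⋀[k]^(c + 1) V →ₗ[k] V)
    (h : a + j = p) (h' : (c + 1) + d = q + 1) :
    insertRight (g + g') h h' = insertRight g h h' + insertRight g' h h' := by
  simp only [insertRight, LinearMap.add_comp, LinearMap.comp_add, LinearMap.rTensor_add,
    LinearMap.lTensor_add]

theorem circComponent_add_left {n m : ℕ} (f f' : Cochain k V n) (g : Cochain k V m) (p q : ℕ)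
    (h : p + q = n + m) :
    circComponent (f + f') g p q h = circComponent f g p q h + circComponent f' g p q h := by
  simp only [circComponent, component_add, LinearMap.add_comp, smul_add, Finset.sum_add_distrib]
  rw [add_add_add_comm]
  congr 1
  · split_ifs
    · rfl
    · rw [add_zero]
  · rw [← Finset.sum_add_distrib]
    refine Finset.sum_congr rfl fun j _ => ?_
    split_ifs
    · rfl
    · rw [add_zero]

theorem circComponent_add_right {n m : ℕ} (f : Cochain k V n) (g g' : Cochain k V m) (p q : ℕ)
    (h : p + q = n + m) :
    circComponent f (g + g') p q h = circComponent f g p q h + circComponent f g' p q h := by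
  simp only [circComponent, component_add, insertLeft_add, insertRight_add, LinearMap.comp_add,
    smul_add, Finset.sum_add_distrib]
  rw [add_add_add_comm]
  congr 1
  · split_ifs
    · rfl
    · rw [add_zero]
  · rw [← Finset.sum_add_distrib]
    refine Finset.sum_congr rfl fun j _ => ?_
    split_ifs
    · rfl
    · rw [add_zero]

theorem ofPair_add (a a' : ⋀[k]^2 V →ₗ[k] V) (b b' : V ⊗[k] V →ₗ[k] V) :
    ofPair (a + a') (b + b') = ofPair a b + ofPair a' b' := by
  funext ⟨⟨i, j⟩, hij⟩
  have hij' : i + j = 1 := Finset.HasAntidiagonal.mem_antidiagonal.mp hij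
  obtain ⟨rfl, rfl⟩ | ⟨rfl, rfl⟩ : (i = 0 ∧ j = 1) ∨ (i = 1 ∧ j = 0) := by omega
  · rfl
  · rfl

end Additivity

/-! ### Post-Lie structures as square-zero elements -/

section MaurerCartan

variable {k : Type*} [Field k] {V : Type*} [AddCommGroup V] [Module k V]

theorem eq_zero_of_apply_ιMulti_tmul_ιMulti {p q : ℕ} (f : ⋀[k]^p V ⊗[k] ⋀[k]^q V →ₗ[k] V)
    (h : ∀ v u, f (ιMulti k p v ⊗ₜ[k] ιMulti k q u) = 0) : f = 0 := by
  refine TensorProduct.ext (linearMap_ext (AlternatingMap.ext fun v => linearMap_ext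
    (AlternatingMap.ext fun u => ?_)))
  exact h v u

theorem map_ιMulti_swap (a : ⋀[k]^2 V →ₗ[k] V) (x y : V) :
    a (ιMulti k 2 ![x, y]) = -a (ιMulti k 2 ![y, x]) := by
  have h := (a.compAlternatingMap (ιMulti k 2)).map_swap ![y, x] (i := 0) (j := 1) (by decide)
  have hs : ![y, x] ∘ Equiv.swap (0 : Fin 2) 1 = ![x, y] := by
    ext i; fin_cases i <;> rfl
  rw [hs] at h
  exact h

theorem circ_add_self {n N : ℕ} (hN : n + n = N) (f g : Cochain k V n) :
    circ hN (f + g) (f + g) =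
      circ hN f f + (circ hN f g + circ hN g f + circ hN g g) := by
  funext i
  simp only [circ, circComponent_add_left, circComponent_add_right, Pi.add_apply]
  abel

variable [CharZero k]

/-- In degree one the sign `-(-1)^{1·1}` is `+1`, so that `½ [ω, ω] = ω ∘ ω`. -/
theorem isMaurerCartan_iff (π ω : Cochain k V 1) :
    IsMaurerCartan π ω ↔ circ rfl π ω + circ rfl ω π + circ rfl ω ω = 0 := by
  have half (c : Cochain k V (1 + 1)) : (2⁻¹ : k) • (c + c) = c := by
    rw [← two_smul k c, smul_smul, inv_mul_cancel₀ two_ne_zero, one_smul]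
  simp only [IsMaurerCartan, differential, bracket, mul_one, pow_one, neg_smul, one_smul,
    sub_neg_eq_add, half]

variable (a : ⋀[k]^2 V →ₗ[k] V) (b : V ⊗[k] V →ₗ[k] V)

theorem circComponent_zero_two_eq_zero_iff :
    circComponent (ofPair a b) (ofPair a b) 0 2 rfl = 0 ↔ ∀ x y z : V,
      a (ιMulti k 2 ![x, a (ιMulti k 2 ![y, z])]) + a (ιMulti k 2 ![y, a (ιMulti k 2 ![z, x])])
        + a (ιMulti k 2 ![z, a (ιMulti k 2 ![x, y])]) = 0 := by
  have key (x y z : V) : circComponent (ofPair a b) (ofPair a b) 0 2 rfl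
      (ιMulti k 0 ![] ⊗ₜ[k] ιMulti k 3 ![x, y, z]) =
      -(a (ιMulti k 2 ![x, a (ιMulti k 2 ![y, z])]) + a (ιMulti k 2 ![y, a (ιMulti k 2 ![z, x])])
        + a (ιMulti k 2 ![z, a (ιMulti k 2 ![x, y])])) := by
    rw [circComponent_zero_two_apply, map_ιMulti_swap a x (a _), map_ιMulti_swap a y (a _),
      map_ιMulti_swap a z (a _)]
    abel
  constructor
  · intro h x y z
    rw [← neg_eq_zero, ← key, h, LinearMap.zero_apply]
  · intro h
    refine eq_zero_of_apply_ιMulti_tmul_ιMulti _ fun v u => ?_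
    rw [Subsingleton.elim v ![], ← FinVec.etaExpand_eq u]
    exact (key _ _ _).trans (neg_eq_zero.mpr (h _ _ _))

theorem circComponent_one_one_eq_zero_iff :
    circComponent (ofPair a b) (ofPair a b) 1 1 rfl = 0 ↔ ∀ x y z : V,
      b (x ⊗ₜ[k] a (ιMulti k 2 ![y, z])) =
        a (ιMulti k 2 ![b (x ⊗ₜ[k] y), z]) + a (ιMulti k 2 ![y, b (x ⊗ₜ[k] z)]) := by
  have key (x y z : V) : circComponent (ofPair a b) (ofPair a b) 1 1 rfl
      (ιMulti k 1 ![x] ⊗ₜ[k] ιMulti k 2 ![y, z]) =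
      a (ιMulti k 2 ![b (x ⊗ₜ[k] y), z]) + a (ιMulti k 2 ![y, b (x ⊗ₜ[k] z)])
        - b (x ⊗ₜ[k] a (ιMulti k 2 ![y, z])) := by
    rw [circComponent_one_one_apply, map_ιMulti_swap a y (b _)]
    abel
  constructor
  · intro h x y z
    rw [eq_comm, ← sub_eq_zero, ← key, h, LinearMap.zero_apply]
  · intro h
    refine eq_zero_of_apply_ιMulti_tmul_ιMulti _ fun v u => ?_
    rw [← FinVec.etaExpand_eq v, ← FinVec.etaExpand_eq u]
    exact (key _ _ _).trans (sub_eq_zero.mpr (h _ _ _).symm)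

theorem circComponent_two_zero_eq_zero_iff :
    circComponent (ofPair a b) (ofPair a b) 2 0 rfl = 0 ↔ ∀ x y z : V,
      b ((a (ιMulti k 2 ![x, y]) + b (x ⊗ₜ[k] y) - b (y ⊗ₜ[k] x)) ⊗ₜ[k] z) =
        b (x ⊗ₜ[k] b (y ⊗ₜ[k] z)) - b (y ⊗ₜ[k] b (x ⊗ₜ[k] z)) := by
  constructor
  · intro h x y z
    rw [← sub_eq_zero, ← circComponent_two_zero_apply, h, LinearMap.zero_apply]
  · intro h
    refine eq_zero_of_apply_ιMulti_tmul_ιMulti _ fun v u => ?_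
    rw [← FinVec.etaExpand_eq v, ← FinVec.etaExpand_eq u]
    exact (circComponent_two_zero_apply a a b b _ _ _).trans (sub_eq_zero.mpr (h _ _ _))

/-- Post-Lie structures on `V` are the elements `π` of `C^1(V, V)` with `π ∘ π = 0`: the components
of `π ∘ π` of index `(0, 2)`, `(1, 1)` and `(2, 0)` are the three axioms. -/
theorem isPostLieAlgebra_iff_circ_self_eq_zero :
    IsPostLieAlgebra a b ↔ circ rfl (ofPair a b) (ofPair a b) = 0 := by
  constructor
  · rintro ⟨hJ, hD, hA⟩
    funext ⟨⟨i, j⟩, hij⟩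
    have hij' : i + j = 1 + 1 := Finset.HasAntidiagonal.mem_antidiagonal.mp hij
    obtain ⟨rfl, rfl⟩ | ⟨rfl, rfl⟩ | ⟨rfl, rfl⟩ :
      (i = 0 ∧ j = 2) ∨ (i = 1 ∧ j = 1) ∨ (i = 2 ∧ j = 0) := by omega
    · exact (circComponent_zero_two_eq_zero_iff a b).mpr hJ
    · exact (circComponent_one_one_eq_zero_iff a b).mpr hD
    · exact (circComponent_two_zero_eq_zero_iff a b).mpr hA
  · intro h
    exact ⟨(circComponent_zero_two_eq_zero_iff a b).mp (congrFun h ⟨(0, 2), by decide⟩),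
      (circComponent_one_one_eq_zero_iff a b).mp (congrFun h ⟨(1, 1), by decide⟩),
      (circComponent_two_zero_eq_zero_iff a b).mp (congrFun h ⟨(2, 0), by decide⟩)⟩

end MaurerCartan

end PostLie

end

theorem mainTheorem11 {k : Type*} [Field k] [CharZero k] {V : Type*} [AddCommGroup V] [Module k V]
    (π₀ : ⋀[k]^2 V →ₗ[k] V) (π₁ : V ⊗[k] V →ₗ[k] V) (hπ : PostLie.IsPostLieAlgebra π₀ π₁)
    (π₀' : ⋀[k]^2 V →ₗ[k] V) (π₁' : V ⊗[k] V →ₗ[k] V) :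
    PostLie.IsPostLieAlgebra (π₀ + π₀') (π₁ + π₁') ↔
      PostLie.IsMaurerCartan (PostLie.ofPair π₀ π₁) (PostLie.ofPair π₀' π₁') := by
  rw [PostLie.isPostLieAlgebra_iff_circ_self_eq_zero] at hπ ⊢
  rw [PostLie.isMaurerCartan_iff, PostLie.ofPair_add, PostLie.circ_add_self, hπ, zero_add]
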